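/- Let $a_{n,k,f}$ be the number of involutions $\pi$ of $\{1,\dots,n\}$ (the identity included, $n\ge 0$) that avoid the classical pattern $3412$, have exactly $k$ occurrences of the consecutive pattern $\underline{123}$ (that is, $k$ indices $i$ with $1\le i\le n-2$ and $\pi_i<\pi_{i+1}<\pi_{i+2}$), and have exactly $f$ fixed points. Put $$F_{\underline{123}}(x,t,z)=\sum_{n,k,f\ge 0}a_{n,k,f}\,x^n t^k z^f\in\mathbb Q[[x,t,z]].$$ **Theorem.** In the field of fractions of $\mathbb Q[[x,t,z]]$, $$F_{\underline{123}}(x,t,z)=\frac{2A^2}{2(1-B)A^2-A^2+A^2C+A^2\sqrt{(1-C)^2-4A^2}},$$ where $$A=x+\frac{x^3z^2(t-1)}{1-xz(t-1)-x^2z^2(t-1)},\qquad B=xz+\frac{x^3z^3(t-1)}{1-xz(t-1)-x^2z^2(t-1)},$$ $$C=xz+\frac{x^3z^2(t-1)\bigl(z+x(t-1)+x^2(t-1)z\bigr)}{1-xz(t-1)-x^2z^2(t-1)}+x^3(t-1)z,$$ and $\sqrt{(1-C)^2-4A^2}$ denotes the unique formal power series in $x,t,z$ with constant term $1$ whose square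 is $(1-C)^2-4A^2$. All the denominators above are nonzero. -/

import Mathlib

noncomputable section

namespace PatternInvolutions

/-- The word `τ` (one-line notation of a pattern of length `m`) is order isomorphic to
the word `w`. -/
def SameOrder {m n : ℕ} (τ : Fin m → ℕ) (w : Fin m → Fin n) : Prop :=
  ∀ a b : Fin m, τ a < τ b ↔ w a < w b

/-- `π` contains the pattern `τ` in the classical sense: some subsequence of the one-line
notation of `π` is order isomorphic to `τ`. -/
def Contains {m n : ℕ} (τ : Fin m → ℕ) (π : Equiv.Perm (Fin n)) : Prop :=
  ∃ f : Fin m → Fin n, StrictMono f ∧ SameOrder τ (fun a => π (f a))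

/-- The number of occurrences of the consecutive pattern `τ` in `π`: the number of index
sequences consisting of `m` adjacent positions of `π` whose letters are order isomorphic
to `τ`. -/
def consecOcc {m n : ℕ} (τ : Fin m → ℕ) (π : Equiv.Perm (Fin n)) : ℕ :=
  Set.ncard {f : Fin m → Fin n |
    (∃ i : ℕ, ∀ a : Fin m, (f a : ℕ) = i + (a : ℕ)) ∧ SameOrder τ (fun a => π (f a))}

/-- The number of fixed points of `π`. -/
def fix {n : ℕ} (π : Equiv.Perm (Fin n)) : ℕ :=
  Set.ncard {i : Fin n | π i = i}

/-- The involutions of length `n` (the identity included) that avoid `3412`. -/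
def I3412 (n : ℕ) : Set (Equiv.Perm (Fin n)) :=
  {π | Function.Involutive π ∧ ¬ Contains ![3, 4, 1, 2] π}

/-- The number of `3412`-avoiding involutions of length `n` with `k` occurrences of the
consecutive pattern `123` and `f` fixed points. -/
def count123 (n k f : ℕ) : ℕ :=
  Set.ncard {π : Equiv.Perm (Fin n) |
    π ∈ I3412 n ∧ consecOcc ![1, 2, 3] π = k ∧ fix π = f}

/-- Formal power series over `ℚ` in the three variables `x = X 0`, `t = X 1`, `z = X 2`. -/
abbrev Series : Type := MvPowerSeries (Fin 3) ℚ

/-- The generating function `∑ a_{n,k,f} x^n t^k z^f`. -/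
def F123 : Series := fun e => (count123 (e 0) (e 1) (e 2) : ℚ)

/-- The field of fractions of the ring of formal power series; it contains the rational
functions in `x`, `t`, `z`. -/
abbrev Frac : Type := FractionRing Series

/-- The embedding of power series in their field of fractions. -/
abbrev toFrac : Series →+* Frac := algebraMap Series Frac

section
variable {K : Type*} [Field K]

/-- The common denominator in `A`, `B`, `C`. -/
def den (x t z : K) : K := 1 - x * z * (t - 1) - x ^ 2 * z ^ 2 * (t - 1)

/-- The rational function `A`. -/
def A (x t z : K) : K := x + x ^ 3 * z ^ 2 * (t - 1) / den x t z

/-- The rational function `B`. -/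
def B (x t z : K) : K := x * z + x ^ 3 * z ^ 3 * (t - 1) / den x t z

/-- The rational function `C`. -/
def C (x t z : K) : K :=
  x * z + x ^ 3 * z ^ 2 * (t - 1) * (z + x * (t - 1) + x ^ 2 * (t - 1) * z) / den x t z
    + x ^ 3 * (t - 1) * z

end

end PatternInvolutions

end

/-! An involution avoids `3412` exactly when its arcs do not cross (`isNoncrossing_extendNat_iff`):
arcs `i < j < π i < π j` spell `3412` at these four positions. Splitting off the block of the first
point, which is either a fixed point or an arc with something under it and something to its right,
turns noncrossing involutions into Motzkin trees (`exists_toFun_eq`, `toFun_injective`).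

Both statistics are recursive in the tree. Under an arc, the opening entry exceeds the next entry
and the closing entry lies below the one before it, so no double ascent enters or leaves the inside.
A fixed point or a closing entry is smaller than everything to its right, so it creates a double
ascent exactly when the remainder begins with an ascent. With `F` the wanted series and `P` the
series in which a smaller entry precedes the word, this gives `F = 1 + xzP + x²FP` and `P = 1 + xz +
xtz(P - 1) + x²FP`.

Eliminating `P` leaves a quadratic equation for `F` (`F123_quadratic`). Completing the square shows
that `2/F - 1 - C + 2B` squares to `(1 - C)² - 4A²` (`sq_eq_of_quadratic`). It is a power series
with constant term `1`, hence the prescribed square root, and solving for `F` gives the formula. -/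

namespace PatternInvolutions

/-! ### Generating functions of weighted types -/

section WeightSeries
variable {σ T U : Type*}

/-- The generating function `∑ X ^ w t` of the elements `t` of a type with weights `w t`,
for a weight with finite fibres. -/
noncomputable def weightSeries (w : T → σ →₀ ℕ) : MvPowerSeries σ ℚ :=
  fun e => (Set.ncard {t | w t = e} : ℚ)

theorem coeff_weightSeries (w : T → σ →₀ ℕ) (e : σ →₀ ℕ) :
    MvPowerSeries.coeff e (weightSeries w) = (Set.ncard {t | w t = e} : ℚ) := rfl

theorem weightSeries_comp_equiv (w : T → σ →₀ ℕ) (φ : U ≃ T) :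
    weightSeries (w ∘ φ) = weightSeries w := by
  ext e
  rw [coeff_weightSeries, coeff_weightSeries]
  congr 1
  rw [← Set.ncard_image_of_injective _ φ.injective]
  congr 1
  ext t
  simp only [Set.mem_image, Set.mem_ofPred_eq, Function.comp]
  exact ⟨by rintro ⟨u, hu, rfl⟩; exact hu, fun h => ⟨φ.symm t, by simpa using h, by simp⟩⟩

/-- Finite fibres are needed because `Set.ncard` is `0` on infinite sets. -/
theorem weightSeries_sum (w : T ⊕ U → σ →₀ ℕ) (hw : ∀ e, {t | w t = e}.Finite) :
    weightSeries w = weightSeries (w ∘ Sum.inl) + weightSeries (w ∘ Sum.inr) := by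
  ext e
  rw [map_add, coeff_weightSeries, coeff_weightSeries, coeff_weightSeries, ← Nat.cast_add]
  congr 1
  have h : {t | w t = e} = Sum.inl '' {t | (w ∘ Sum.inl) t = e} ∪
      Sum.inr '' {t | (w ∘ Sum.inr) t = e} := by
    ext (t | t) <;> simp
  have hf := hw e
  rw [h] at hf
  rw [h, Set.ncard_union_eq _ (hf.subset Set.subset_union_left)
    (hf.subset Set.subset_union_right), Set.ncard_image_of_injective _ Sum.inl_injective,
    Set.ncard_image_of_injective _ Sum.inr_injective]
  rw [Set.disjoint_left]
  rintro _ ⟨t, -, rfl⟩ ⟨u, -, hu⟩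
  exact Sum.inl_ne_inr hu.symm

theorem setOf_add_eq [DecidableEq σ] [DecidableEq T] [DecidableEq U]
    (v : T → σ →₀ ℕ) (w : U → σ →₀ ℕ)
    (hv : ∀ e, {t | v t = e}.Finite) (hw : ∀ e, {t | w t = e}.Finite) (e : σ →₀ ℕ) :
    {p : T × U | v p.1 + w p.2 = e} = ↑((Finset.HasAntidiagonal.antidiagonal e).biUnion
      fun q => ((hv q.1).toFinset ×ˢ (hw q.2).toFinset)) := by
  ext ⟨a, b⟩
  simp

theorem finite_add_eq (v : T → σ →₀ ℕ) (w : U → σ →₀ ℕ)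
    (hv : ∀ e, {t | v t = e}.Finite) (hw : ∀ e, {t | w t = e}.Finite) (e : σ →₀ ℕ) :
    {p : T × U | v p.1 + w p.2 = e}.Finite := by
  classical
  rw [setOf_add_eq v w hv hw]
  exact Finset.finite_toSet _

theorem weightSeries_prod (v : T → σ →₀ ℕ) (w : U → σ →₀ ℕ)
    (hv : ∀ e, {t | v t = e}.Finite) (hw : ∀ e, {t | w t = e}.Finite) :
    weightSeries (fun p : T × U => v p.1 + w p.2) = weightSeries v * weightSeries w := by
  classical
  ext e
  rw [MvPowerSeries.coeff_mul, coeff_weightSeries]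
  simp only [coeff_weightSeries, ← Nat.cast_mul, ← Nat.cast_sum]
  congr 1
  rw [setOf_add_eq v w hv hw, Set.ncard_coe_finset, Finset.card_biUnion]
  · refine Finset.sum_congr rfl fun q _ => ?_
    rw [Finset.card_product, Set.ncard_eq_toFinset_card _ (hv q.1),
      Set.ncard_eq_toFinset_card _ (hw q.2)]
  · intro q _ q' _ hne
    rw [Function.onFun, Finset.disjoint_left]
    rintro ⟨a, b⟩ h1 h2
    simp only [Finset.mem_product, Set.Finite.mem_toFinset, Set.mem_ofPred_eq] at h1 h2
    exact hne (Prod.ext (h1.1.symm.trans h2.1) (h1.2.symm.trans h2.2))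

theorem weightSeries_unit (w : Unit → σ →₀ ℕ) :
    weightSeries w = MvPowerSeries.monomial (w ()) 1 := by
  classical
  ext e
  rw [coeff_weightSeries, MvPowerSeries.coeff_monomial]
  by_cases h : e = w ()
  · have : {t | w t = e} = {()} := by ext; simp [h]
    rw [this, Set.ncard_singleton]; simp [h]
  · have : {t | w t = e} = ∅ := by
      ext t; simpa using fun h' => h (h'.symm)
    rw [this, Set.ncard_empty]; simp [h]

theorem weightSeries_add_const (d : σ →₀ ℕ) (w : T → σ →₀ ℕ)
    (hw : ∀ e, {t | w t = e}.Finite) :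
    weightSeries (fun t => d + w t) = MvPowerSeries.monomial d 1 * weightSeries w := by
  rw [← weightSeries_unit fun _ => d, ← weightSeries_prod _ _ (fun _ => Set.toFinite _) hw,
    ← weightSeries_comp_equiv _ (Equiv.punitProd T).symm]
  rfl

end WeightSeries

/-! ### Motzkin trees and their statistics -/

/-- Motzkin trees: the shapes of noncrossing involutions, read from the left. -/
inductive Shape : Type
  | nil : Shape
  | level : Shape → Shape
  | arc : Shape → Shape → Shape

namespace Shape

/-- The number of points. -/
def size : Shape → ℕ
  | nil => 0
  | level t => 1 + size t
  | arc s t => 2 + (size s + size t)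

/-- The number of fixed points. -/
def fixed : Shape → ℕ
  | nil => 0
  | level t => 1 + fixed t
  | arc s t => fixed s + fixed t

/-- The number (`0` or `1`) of ascents at the first position. -/
def firstAscent : Shape → ℕ
  | nil => 0
  | level nil => 0
  | level _ => 1
  | arc _ _ => 0

/-- The number of double ascents. -/
def doubleAscents : Shape → ℕ
  | nil => 0
  | level t => doubleAscents t + firstAscent t
  | arc s t => doubleAscents s + (doubleAscents t + firstAscent t)

/-- The exponent `(n, k, f)` of a shape. -/
noncomputable def weight (t : Shape) : Fin 3 →₀ ℕ :=
  Finsupp.single 0 t.size + Finsupp.single 1 t.doubleAscents + Finsupp.single 2 t.fixed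

/-- The exponent of a shape to the left of which a smaller entry is placed. -/
noncomputable def weightPreceded (t : Shape) : Fin 3 →₀ ℕ :=
  t.weight + Finsupp.single 1 t.firstAscent

/-- A shape is a choice of its first block and of the remaining shape. -/
def equivBlocks : Shape ≃ Unit ⊕ (Shape ⊕ Shape × Shape) where
  toFun
    | nil => .inl ()
    | level t => .inr (.inl t)
    | arc s t => .inr (.inr (s, t))
  invFun
    | .inl _ => nil
    | .inr (.inl t) => level t
    | .inr (.inr p) => arc p.1 p.2
  left_inv t := by cases t <;> rfl
  right_inv t := by rcases t with _ | _ | _ <;> rfl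

theorem finite_size_eq (n : ℕ) : {t : Shape | t.size = n}.Finite := by
  induction n using Nat.strong_induction_on with
  | _ n ih =>
    have hlt : {t : Shape | t.size < n}.Finite := by
      have : {t : Shape | t.size < n} = ⋃ m ∈ Set.Iio n, {t : Shape | t.size = m} := by
        ext; simp
      rw [this]
      exact (Set.finite_Iio n).biUnion fun m hm => ih m hm
    refine (((Set.finite_singleton nil).union (hlt.image level)).union
      (Set.Finite.image2 arc hlt hlt)).subset ?_
    rintro (_ | t | ⟨s, t⟩) ht
    · exact Or.inl (Or.inl rfl)
    · exact Or.inl (Or.inr ⟨t, by simp only [Set.mem_ofPred_eq, size] at ht ⊢; omega, rfl⟩)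
    · simp only [Set.mem_ofPred_eq, size] at ht
      exact Or.inr ⟨s, by simp only [Set.mem_ofPred_eq]; omega, t,
        by simp only [Set.mem_ofPred_eq]; omega, rfl⟩

theorem weight_zero (t : Shape) : t.weight 0 = t.size := by simp [weight]
theorem weight_one (t : Shape) : t.weight 1 = t.doubleAscents := by simp [weight]
theorem weight_two (t : Shape) : t.weight 2 = t.fixed := by simp [weight]

theorem weightPreceded_zero (t : Shape) : t.weightPreceded 0 = t.size := by
  simp [weightPreceded, weight]

theorem finite_weight_eq (e : Fin 3 →₀ ℕ) : {t : Shape | t.weight = e}.Finite :=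
  (finite_size_eq (e 0)).subset fun t ht => by
    rw [Set.mem_ofPred_eq] at ht ⊢; rw [← ht, weight_zero]

theorem finite_weightPreceded_eq (e : Fin 3 →₀ ℕ) :
    {t : Shape | t.weightPreceded = e}.Finite :=
  (finite_size_eq (e 0)).subset fun t ht => by
    rw [Set.mem_ofPred_eq] at ht ⊢; rw [← ht, weightPreceded_zero]

theorem weight_level (t : Shape) : (level t).weight =
    (Finsupp.single 0 1 + Finsupp.single 2 1) + t.weightPreceded := by
  ext i
  fin_cases i <;> simp [weight, weightPreceded, size, fixed, doubleAscents]

theorem weight_arc (s t : Shape) : (arc s t).weight =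
    Finsupp.single 0 2 + (s.weight + t.weightPreceded) := by
  ext i
  fin_cases i <;> simp [weight, weightPreceded, size, fixed, doubleAscents, add_assoc]

theorem weightPreceded_arc (s t : Shape) : (arc s t).weightPreceded =
    Finsupp.single 0 2 + (s.weight + t.weightPreceded) := by
  rw [weightPreceded, weight_arc]; simp [firstAscent]

theorem weightPreceded_level (t : Shape) (ht : t ≠ nil) : (level t).weightPreceded =
    (Finsupp.single 0 1 + Finsupp.single 1 1 + Finsupp.single 2 1) + t.weightPreceded := by
  rw [weightPreceded, weight_level]
  cases t <;> simp_all [firstAscent] <;> abel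

theorem finite_comp {T U V : Type*} {w : T → V} (hw : ∀ e, {t | w t = e}.Finite) {φ : U → T}
    (hφ : Function.Injective φ) (e : V) : {u | (w ∘ φ) u = e}.Finite :=
  (hw e).preimage hφ.injOn

end Shape

/-! ### Functional equations -/

open Shape MvPowerSeries

/-- The generating function of the shapes by `weightPreceded`. -/
noncomputable def precededSeries : Series := weightSeries weightPreceded

theorem monomial_x2 : (monomial (Finsupp.single 0 2) 1 : Series) = X 0 ^ 2 := by
  rw [X_pow_eq]

theorem monomial_xz : (monomial (Finsupp.single 0 1 + Finsupp.single 2 1) 1 : Series) =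
    X 0 * X 2 := by
  rw [X, X, monomial_mul_monomial, one_mul]

theorem monomial_xtz :
    (monomial (Finsupp.single 0 1 + Finsupp.single 1 1 + Finsupp.single 2 1) 1 : Series) =
    X 0 * X 1 * X 2 := by
  rw [X, X, X, monomial_mul_monomial, monomial_mul_monomial, one_mul, one_mul]

theorem weightSeries_blocks (w : Shape → Fin 3 →₀ ℕ) (hw : ∀ e, {t | w t = e}.Finite) :
    weightSeries w = monomial (w nil) 1 + (weightSeries (fun t => w (level t)) +
      weightSeries (fun p : Shape × Shape => w (arc p.1 p.2))) := by
  have h1 := finite_comp hw equivBlocks.symm.injective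
  rw [← weightSeries_comp_equiv w equivBlocks.symm, weightSeries_sum _ h1, weightSeries_unit,
    weightSeries_sum _ (finite_comp h1 Sum.inr_injective)]
  rfl

theorem weight_nil : nil.weight = 0 := by simp [weight, size, doubleAscents, fixed]
theorem weightPreceded_nil : nil.weightPreceded = 0 := by
  simp [weightPreceded, weight_nil, firstAscent]

theorem weightSeries_arc : weightSeries (fun p : Shape × Shape => Finsupp.single 0 2 +
      (p.1.weight + p.2.weightPreceded)) =
    X 0 ^ 2 * (weightSeries weight * precededSeries) := by
  rw [weightSeries_add_const _ (fun p : Shape × Shape => p.1.weight + p.2.weightPreceded)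
      (finite_add_eq _ _ finite_weight_eq finite_weightPreceded_eq),
    weightSeries_prod _ _ finite_weight_eq finite_weightPreceded_eq, monomial_x2]
  rfl

theorem weightSeries_weight : weightSeries weight = 1 + (X 0 * X 2 * precededSeries +
    X 0 ^ 2 * (weightSeries weight * precededSeries)) := by
  conv_lhs => rw [weightSeries_blocks _ finite_weight_eq]
  simp only [weight_level, weight_arc, weight_nil]
  rw [weightSeries_add_const _ _ finite_weightPreceded_eq, weightSeries_arc, monomial_xz,
    monomial_zero_one]
  rfl

/-- A leading fixed point contributes `t` only if something follows it, since only then is there an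
ascent. So the `level` term is decomposed once more by its remainder: `nil` gives `xz`, all else
gives `xtz(P - 1)`. -/
theorem precededSeries_eq : precededSeries =
    1 + (X 0 * X 2 + X 0 * X 1 * X 2 * (precededSeries - 1) +
      X 0 ^ 2 * (weightSeries weight * precededSeries)) := by
  have hinj : Function.Injective level := fun s t h => by injection h
  have hP := weightSeries_blocks _ finite_weightPreceded_eq
  have hL := weightSeries_blocks _ (finite_comp finite_weightPreceded_eq hinj)
  have h1 : ∀ t, (level (level t)).weightPreceded = (Finsupp.single 0 1 + Finsupp.single 1 1 +
      Finsupp.single 2 1) + (level t).weightPreceded := fun t =>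
    weightPreceded_level _ (by simp)
  have h2 : ∀ p : Shape × Shape, (level (arc p.1 p.2)).weightPreceded = (Finsupp.single 0 1 +
      Finsupp.single 1 1 + Finsupp.single 2 1) + (arc p.1 p.2).weightPreceded := fun p =>
    weightPreceded_level _ (by simp)
  have h0 : (level nil).weightPreceded = Finsupp.single 0 1 + Finsupp.single 2 1 := by
    rw [weightPreceded, weight_level]; simp [weightPreceded_nil, firstAscent]
  have harc : Function.Injective fun p : Shape × Shape => arc p.1 p.2 := by
    rintro ⟨a, b⟩ ⟨c, d⟩ h
    simpa using h
  simp only [Function.comp_def, h1, h2, h0] at hL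
  rw [weightSeries_add_const _ (fun t => (level t).weightPreceded)
      (finite_comp finite_weightPreceded_eq hinj),
    weightSeries_add_const _ (fun p : Shape × Shape => (arc p.1 p.2).weightPreceded)
      (finite_comp finite_weightPreceded_eq harc), monomial_xz, monomial_xtz] at hL
  simp only [weightPreceded_nil, monomial_zero_one, weightPreceded_arc, weightSeries_arc]
    at hP hL
  change precededSeries = _ at hP
  linear_combination hP + hL - X 0 * X 1 * X 2 * hP

/-- With `u = xz + x²F` and `v = xtz + x²F`, the two equations read `F - 1 - u = u(P - 1)` and `(P -
1)(1 - v) = u`; multiply the first by `1 - v`. -/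
theorem weightSeries_weight_quadratic {F : Series} (hF : F = weightSeries weight) :
    (F - 1 - (X 0 * X 2 + X 0 ^ 2 * F)) * (1 - (X 0 * X 1 * X 2 + X 0 ^ 2 * F)) =
      (X 0 * X 2 + X 0 ^ 2 * F) ^ 2 := by
  have h1 := weightSeries_weight
  have h2 := precededSeries_eq
  rw [← hF] at h1 h2
  linear_combination (1 - (X 0 * X 1 * X 2 + X 0 ^ 2 * F)) * h1 +
    (X 0 * X 2 + X 0 ^ 2 * F) * h2

/-! ### Trees as noncrossing involutions -/

/-- `g` is an involution moving only points of `[a, a + n)`, without crossing arcs. -/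
structure IsNoncrossing (g : ℕ → ℕ) (a n : ℕ) : Prop where
  lt : ∀ i, i < a → g i = i
  ge : ∀ i, a + n ≤ i → g i = i
  inv : ∀ i, g (g i) = i
  nc : ∀ i j, i < j → j < g i → g j < g i

theorem IsNoncrossing.mem {g : ℕ → ℕ} {a n : ℕ} (h : IsNoncrossing g a n) (i : ℕ)
    (h1 : a ≤ i) (h2 : i < a + n) : a ≤ g i ∧ g i < a + n := by
  have h3 := h.lt (g i)
  have h4 := h.ge (g i)
  rw [h.inv] at h3 h4
  omega

namespace Shape

/-- The noncrossing involution of shape `t` on the points starting at `a`. -/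
def toFun : Shape → ℕ → ℕ → ℕ
  | nil, _, i => i
  | level t, a, i => toFun t (a + 1) i
  | arc s t, a, i => if i = a then a + 1 + size s else if i = a + 1 + size s then a else
      if i < a + 1 + size s then toFun s (a + 1) i else toFun t (a + 2 + size s) i

theorem isNoncrossing_toFun (t : Shape) (a : ℕ) : IsNoncrossing (t.toFun a) a t.size := by
  induction t generalizing a with
  | nil => constructor <;> simp [toFun]
  | level t ih =>
    have h := ih (a + 1)
    refine ⟨fun i hi => h.lt i (by omega), fun i hi => h.ge i ?_, h.inv, h.nc⟩
    simp only [size] at hi; omega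
  | arc s t hs ht =>
    have h1 := hs (a + 1)
    have h2 := ht (a + 2 + size s)
    have m1 := h1.mem
    have m2 := h2.mem
    obtain ⟨l1, g1, i1, n1⟩ := h1
    obtain ⟨l2, g2, i2, n2⟩ := h2
    constructor
    · intro i hi
      have := l1 i (by omega)
      simp only [toFun]; split_ifs <;> omega
    · intro i hi
      simp only [size] at hi
      have := g2 i (by omega)
      simp only [toFun]; split_ifs <;> omega
    · intro i
      have := l1 i
      have := m1 i
      have := i1 i
      have := m2 i
      have := i2 i
      have := g2 i
      simp only [toFun]; split_ifs <;> omega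
    · intro i j
      have := l1 i
      have := m1 i
      have := n1 i j
      have := m1 j
      have := m2 i
      have := m2 j
      have := n2 i j
      have := g2 i
      have := l1 j
      have := g2 j
      simp only [toFun]; split_ifs <;> omega

theorem toFun_level_self (t : Shape) (a : ℕ) : (level t).toFun a a = a :=
  (isNoncrossing_toFun t (a + 1)).lt a (by omega)

theorem toFun_arc_self (s t : Shape) (a : ℕ) : (arc s t).toFun a a = a + 1 + s.size := by
  simp [toFun]

theorem toFun_arc_end (s t : Shape) (a : ℕ) :
    (arc s t).toFun a (a + 1 + s.size) = a := by
  simp [toFun]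

theorem toFun_arc_left (s t : Shape) (a i : ℕ) (h1 : a < i) (h2 : i < a + 1 + s.size) :
    (arc s t).toFun a i = s.toFun (a + 1) i := by
  rw [toFun, if_neg (by omega), if_neg (by omega), if_pos h2]

theorem toFun_arc_right (s t : Shape) (a i : ℕ) (h : a + 1 + s.size < i) :
    (arc s t).toFun a i = t.toFun (a + 2 + s.size) i := by
  rw [toFun, if_neg (by omega), if_neg (by omega), if_neg (by omega)]

/-- The first value recovers the type of the first block and the length of its arc. Equal sizes must
be assumed: trees made of fixed points only all give the identity. -/
theorem toFun_injective (s t : Shape) (a : ℕ) (hsize : s.size = t.size)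
    (h : s.toFun a = t.toFun a) : s = t := by
  induction s generalizing t a with
  | nil => cases t with
    | nil => rfl
    | level t => simp only [size] at hsize; omega
    | arc t t' => simp only [size] at hsize; omega
  | level s ih => cases t with
    | nil => simp only [size] at hsize; omega
    | level t =>
      rw [ih t (a + 1) (by simp only [size] at hsize; omega) h]
    | arc t t' =>
      have := congrFun h a
      rw [toFun_level_self, toFun_arc_self] at this
      omega
  | arc s s' ih ih' => cases t with
    | nil => simp only [size] at hsize; omega
    | level t =>
      have := congrFun h a
      rw [toFun_level_self, toFun_arc_self] at this
      omega
    | arc t t' =>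
      have h0 := congrFun h a
      rw [toFun_arc_self, toFun_arc_self] at h0
      have h1 : s.size = t.size := by omega
      simp only [size] at hsize
      rw [ih t (a + 1) h1, ih' t' (a + 2 + s.size) (by omega)]
      · funext i
        by_cases hi : a + 1 + s.size < i
        · have := congrFun h i
          rwa [toFun_arc_right _ _ _ _ hi, toFun_arc_right _ _ _ _ (by omega), ← h1] at this
        · rw [(isNoncrossing_toFun _ _).lt i (by omega),
            (isNoncrossing_toFun _ _).lt i (by omega)]
      · funext i
        by_cases hi : i < a + 1 + s.size
        · by_cases hi' : a < i
          · have := congrFun h i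
            rwa [toFun_arc_left _ _ _ _ hi' hi, toFun_arc_left _ _ _ _ hi' (by omega)] at this
          · rw [(isNoncrossing_toFun _ _).lt i (by omega),
              (isNoncrossing_toFun _ _).lt i (by omega)]
        · rw [(isNoncrossing_toFun _ _).ge i (by omega),
            (isNoncrossing_toFun _ _).ge i (by omega)]

theorem exists_toFun_eq (n a : ℕ) (g : ℕ → ℕ) (hg : IsNoncrossing g a n) :
    ∃ t : Shape, t.size = n ∧ t.toFun a = g := by
  induction n using Nat.strong_induction_on generalizing a g with
  | _ n ih =>
    rcases n with _ | n
    · refine ⟨nil, rfl, funext fun i => ?_⟩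
      rcases lt_or_ge i a with h | h
      · exact (hg.lt i h).symm
      · exact (hg.ge i h).symm
    obtain ⟨m1, m2⟩ := hg.mem a le_rfl (by omega)
    have mem := hg.mem
    obtain ⟨l, r, inv, nc⟩ := hg
    rcases m1.eq_or_lt with h0 | h0
    · obtain ⟨t, ht, ht'⟩ := ih n (by omega) (a + 1) g ⟨fun i hi => by
        rcases eq_or_ne i a with rfl | h
        · exact h0.symm
        · exact l i (by omega), fun i hi => r i (by omega), inv, nc⟩
      exact ⟨level t, by rw [size, ht]; omega, ht'⟩
    -- The arc from `a` to `g a` separates the points: no arc joins its inside to its right.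
    · have inside : ∀ i, a < i → i < g a → a < g i ∧ g i < g a := by
        intro i h1 h2
        have h3 := nc a i h1 h2
        have h4 := mem i (by omega) (by omega)
        have h5 := inv i
        rcases eq_or_ne (g i) a with h6 | h6
        · rw [h6] at h5; omega
        · omega
      have right : ∀ i, g a < i → g a < g i := by
        intro i h1
        by_contra h
        have h2 := inv i
        rcases lt_or_ge (g i) a with h3 | h3
        · have := l _ h3; omega
        rcases eq_or_ne (g i) (g a) with h4 | h4
        · have := inv a; rw [← h4] at this; omega
        rcases eq_or_ne (g i) a with h5 | h5
        · rw [h5] at h2; omega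
        · have := inside (g i) (by omega) (by omega); omega
      -- Each side of the separating arc, extended by the identity, is again noncrossing.
      obtain ⟨s, hs, hs'⟩ := ih (g a - a - 1) (by omega) (a + 1)
        (fun i => if a < i ∧ i < g a then g i else i) ⟨by
          intro i hi; exact if_neg (by omega), by
          intro i hi; exact if_neg (by omega), by
          intro i
          have := inside i
          have := inv i
          split_ifs <;> omega, by
          intro i j h1
          have := inside i
          have := inside j
          have := nc i j h1
          split_ifs <;> omega⟩
      obtain ⟨t, ht, ht'⟩ := ih (a + n - g a) (by omega) (g a + 1)
        (fun i => if g a < i then g i else i) ⟨by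
          intro i hi; exact if_neg (by omega), by
          intro i hi
          have := r i (by omega)
          split_ifs <;> omega, by
          intro i
          have := right i
          have := inv i
          split_ifs <;> omega, by
          intro i j h1
          have := right i
          have := right j
          have := nc i j h1
          split_ifs <;> omega⟩
      have hD : a + 1 + s.size = g a := by omega
      refine ⟨arc s t, by rw [size]; omega, funext fun i => ?_⟩
      rw [toFun, hD, show a + 2 + s.size = g a + 1 by omega, hs', ht']
      have := inv a
      rcases lt_trichotomy i a with h1 | rfl | h1
      · rw [if_neg (by omega), if_neg (by omega), if_pos (by omega)]
        exact (if_neg (by omega)).trans (l i h1).symm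
      · rw [if_pos rfl]
      rw [if_neg (by omega)]
      rcases lt_trichotomy i (g a) with h2 | rfl | h2
      · rw [if_neg (by omega), if_pos h2]
        exact if_pos ⟨h1, h2⟩
      · rw [if_pos rfl, this]
      · rw [if_neg (by omega), if_neg (by omega)]
        exact if_pos h2

/-! ### The recursive statistics count ascents and fixed points -/

theorem firstAscent_eq (t : Shape) (a : ℕ) :
    (if 1 < t.size ∧ t.toFun a a < t.toFun a (a + 1) then 1 else 0) = t.firstAscent := by
  cases t with
  | nil => simp [size, firstAscent]
  | level t =>
    rw [toFun_level_self]
    have h : 0 < t.size → a < (level t).toFun a (a + 1) := fun h =>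
      ((isNoncrossing_toFun t (a + 1)).mem (a + 1) le_rfl (by omega)).1
    cases t with
    | nil => simp [size, firstAscent]
    | level t => exact if_pos ⟨by simp only [size]; omega, h (by simp only [size]; omega)⟩
    | arc s t => exact if_pos ⟨by simp only [size]; omega, h (by simp only [size]; omega)⟩
  | arc s t =>
    rw [toFun_arc_self, firstAscent, if_neg]
    rintro ⟨-, h⟩
    rcases Nat.eq_zero_or_pos s.size with h0 | h0
    · have := toFun_arc_end s t a
      rw [h0, add_zero] at this
      omega
    · rw [toFun_arc_left _ _ _ _ (by omega) (by omega)] at h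
      have := (isNoncrossing_toFun s (a + 1)).mem (a + 1) le_rfl (by omega)
      omega

/-- Splitting a sum over the points of an arc shape. -/
theorem sum_arc (f : ℕ → ℕ) (a m n : ℕ) : ∑ i ∈ Finset.Ico a (a + (2 + (m + n))), f i =
    f a + (∑ i ∈ Finset.Ico (a + 1) (a + 1 + m), f i) + f (a + 1 + m) +
      ∑ i ∈ Finset.Ico (a + 2 + m) (a + 2 + m + n), f i := by
  rw [Finset.sum_eq_sum_Ico_succ_bot (by omega), ← Finset.sum_Ico_consecutive f
    (show a + 1 ≤ a + 1 + m by omega) (show a + 1 + m ≤ a + (2 + (m + n)) by omega),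
    Finset.sum_eq_sum_Ico_succ_bot (show a + 1 + m < a + (2 + (m + n)) by omega),
    show a + 1 + m + 1 = a + 2 + m by omega, show a + (2 + (m + n)) = a + 2 + m + n by omega]
  omega

theorem sum_level (f : ℕ → ℕ) (a n : ℕ) : ∑ i ∈ Finset.Ico a (a + (1 + n)), f i =
    f a + ∑ i ∈ Finset.Ico (a + 1) (a + 1 + n), f i := by
  rw [Finset.sum_eq_sum_Ico_succ_bot (by omega), add_assoc a 1 n]

theorem fixed_eq (t : Shape) (a : ℕ) :
    ∑ i ∈ Finset.Ico a (a + t.size), (if t.toFun a i = i then 1 else 0) = t.fixed := by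
  induction t generalizing a with
  | nil => simp [size, fixed]
  | level t ih =>
    rw [size, sum_level, toFun_level_self, if_pos rfl, fixed, ← ih (a + 1)]
    rfl
  | arc s t hs ht =>
    rw [size, sum_arc, toFun_arc_self, toFun_arc_end, if_neg (by omega), if_neg (by omega),
      fixed, ← hs (a + 1), ← ht (a + 2 + s.size)]
    have h1 : ∀ i ∈ Finset.Ico (a + 1) (a + 1 + s.size),
        (if (arc s t).toFun a i = i then 1 else 0) =
          if s.toFun (a + 1) i = i then 1 else 0 := by
      intro i hi
      rw [Finset.mem_Ico] at hi
      rw [toFun_arc_left _ _ _ _ (by omega) (by omega)]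
    have h2 : ∀ i ∈ Finset.Ico (a + 2 + s.size) (a + 2 + s.size + t.size),
        (if (arc s t).toFun a i = i then 1 else 0) =
          if t.toFun (a + 2 + s.size) i = i then 1 else 0 := by
      intro i hi
      rw [Finset.mem_Ico] at hi
      rw [toFun_arc_right _ _ _ _ (by omega)]
    rw [Finset.sum_congr rfl h1, Finset.sum_congr rfl h2]
    omega

theorem doubleAscents_eq (t : Shape) (a : ℕ) :
    ∑ i ∈ Finset.Ico a (a + t.size), (if i + 2 < a + t.size ∧
      t.toFun a i < t.toFun a (i + 1) ∧ t.toFun a (i + 1) < t.toFun a (i + 2) then 1 else 0) =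
    t.doubleAscents := by
  induction t generalizing a with
  | nil => simp [size, doubleAscents]
  | level t ih =>
    rw [size, sum_level, doubleAscents, ← ih (a + 1), ← firstAscent_eq t (a + 1), add_comm]
    congr 1
    · rw [← add_assoc]; rfl
    · rw [toFun_level_self]
      refine if_congr ⟨fun h => ⟨by omega, h.2.2⟩, fun h => ⟨by omega, ?_, h.2⟩⟩ rfl rfl
      exact ((isNoncrossing_toFun t (a + 1)).mem (a + 1) le_rfl (by omega)).1
  | arc s t hs ht =>
    have ms := (isNoncrossing_toFun s (a + 1)).mem
    have mt := (isNoncrossing_toFun t (a + 2 + s.size)).mem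
    have e0 := toFun_arc_self s t a
    have e1 := toFun_arc_end s t a
    have el := toFun_arc_left s t a
    have er := toFun_arc_right s t a
    rw [doubleAscents, ← hs (a + 1), ← ht (a + 2 + s.size),
      ← firstAscent_eq t (a + 2 + s.size), size, sum_arc]
    generalize (arc s t).toFun a = g at *
    -- The opening entry is followed by a descent.
    rw [if_neg]
    swap
    · rintro ⟨h1, h2, h3⟩
      rcases Nat.eq_zero_or_pos s.size with h0 | h0
      · rw [h0, add_zero] at e1; omega
      · have := el (a + 1) (by omega) (by omega)
        have := ms (a + 1) (by omega) (by omega)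
        omega
    have h1 : ∀ i ∈ Finset.Ico (a + 1) (a + 1 + s.size),
        (if i + 2 < a + (2 + (s.size + t.size)) ∧ g i < g (i + 1) ∧ g (i + 1) < g (i + 2)
          then 1 else 0) =
        if i + 2 < a + 1 + s.size ∧ s.toFun (a + 1) i < s.toFun (a + 1) (i + 1) ∧
          s.toFun (a + 1) (i + 1) < s.toFun (a + 1) (i + 2) then 1 else 0 := by
      intro i hi
      rw [Finset.mem_Ico] at hi
      by_cases h : i + 2 < a + 1 + s.size
      · rw [el i (by omega) (by omega), el (i + 1) (by omega) (by omega),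
          el (i + 2) (by omega) (by omega)]
        exact if_congr (and_congr_left' (by omega)) rfl rfl
      -- A window reaching the closing point contains the descent into its value `a`.
      · rw [if_neg, if_neg (by omega)]
        rintro ⟨h1, h2, h3⟩
        rcases eq_or_ne (i + 1) (a + 1 + s.size) with h4 | h4
        · have := ms i (by omega) (by omega)
          rw [h4, el i (by omega) (by omega)] at h2
          omega
        · have h5 : i + 2 = a + 1 + s.size := by omega
          have := ms (i + 1) (by omega) (by omega)
          rw [h5, el (i + 1) (by omega) (by omega)] at h3
          omega
    have h2 : ∀ i ∈ Finset.Ico (a + 2 + s.size) (a + 2 + s.size + t.size),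
        (if i + 2 < a + (2 + (s.size + t.size)) ∧ g i < g (i + 1) ∧ g (i + 1) < g (i + 2)
          then 1 else 0) =
        if i + 2 < a + 2 + s.size + t.size ∧
          t.toFun (a + 2 + s.size) i < t.toFun (a + 2 + s.size) (i + 1) ∧
          t.toFun (a + 2 + s.size) (i + 1) < t.toFun (a + 2 + s.size) (i + 2)
          then 1 else 0 := by
      intro i hi
      rw [Finset.mem_Ico] at hi
      rw [er i (by omega), er (i + 1) (by omega), er (i + 2) (by omega)]
      exact if_congr (and_congr_left' (by omega)) rfl rfl
    rw [Finset.sum_congr rfl h1, Finset.sum_congr rfl h2]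
    -- The closing entry `a` lies below all of `t`, so its window needs only the first ascent of
    -- `t`.
    have h3 : (if a + 1 + s.size + 2 < a + (2 + (s.size + t.size)) ∧
          g (a + 1 + s.size) < g (a + 1 + s.size + 1) ∧
          g (a + 1 + s.size + 1) < g (a + 1 + s.size + 2) then 1 else 0) =
        if 1 < t.size ∧ t.toFun (a + 2 + s.size) (a + 2 + s.size) <
          t.toFun (a + 2 + s.size) (a + 2 + s.size + 1) then 1 else 0 := by
      rw [e1, show a + 1 + s.size + 1 = a + 2 + s.size by omega,
        show a + 1 + s.size + 2 = a + 2 + s.size + 1 by omega,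
        er (a + 2 + s.size) (by omega), er (a + 2 + s.size + 1) (by omega)]
      refine if_congr ⟨fun h => ⟨by omega, h.2.2⟩, fun h => ⟨by omega, ?_, h.2⟩⟩ rfl rfl
      have := mt (a + 2 + s.size) le_rfl (by omega)
      omega
    rw [h3]
    omega

end Shape

/-! ### From permutations to trees -/

/-- A permutation of `Fin n` as a function on `ℕ`. -/
def extendNat {n : ℕ} (π : Equiv.Perm (Fin n)) (i : ℕ) : ℕ :=
  if h : i < n then π ⟨i, h⟩ else i

theorem extendNat_coe {n : ℕ} (π : Equiv.Perm (Fin n)) (i : Fin n) :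
    extendNat π i = π i := by
  simp [extendNat]

theorem extendNat_of_lt {n : ℕ} (π : Equiv.Perm (Fin n)) (i : ℕ) (h : i < n) :
    extendNat π i = π ⟨i, h⟩ := dif_pos h

theorem extendNat_of_ge {n : ℕ} (π : Equiv.Perm (Fin n)) (i : ℕ) (h : n ≤ i) :
    extendNat π i = i := dif_neg (by omega)

theorem extendNat_injective (n : ℕ) :
    Function.Injective (extendNat : Equiv.Perm (Fin n) → ℕ → ℕ) := by
  intro π ρ h
  ext i
  rw [← extendNat_coe, h, extendNat_coe]

theorem contains_3412_iff {n : ℕ} (π : Equiv.Perm (Fin n)) : Contains ![3, 4, 1, 2] π ↔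
    ∃ i j k l : Fin n, i < j ∧ j < k ∧ k < l ∧ π k < π l ∧ π l < π i ∧ π i < π j := by
  constructor
  · rintro ⟨f, hf, ho⟩
    refine ⟨f 0, f 1, f 2, f 3, hf (by decide), hf (by decide), hf (by decide), ?_, ?_, ?_⟩
    · exact (ho 2 3).1 (by decide)
    · exact (ho 3 0).1 (by decide)
    · exact (ho 0 1).1 (by decide)
  · rintro ⟨i, j, k, l, h1, h2, h3, h4, h5, h6⟩
    refine ⟨![i, j, k, l], ?_, ?_⟩
    · rw [Fin.strictMono_iff_lt_succ]
      intro a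
      fin_cases a <;> assumption
    · intro a b
      simp only [Fin.lt_def] at *
      fin_cases a <;> fin_cases b <;> simp <;> omega

theorem isNoncrossing_extendNat_iff {n : ℕ} (π : Equiv.Perm (Fin n)) :
    IsNoncrossing (extendNat π) 0 n ↔ π ∈ I3412 n := by
  rw [I3412, Set.mem_ofPred_eq, contains_3412_iff]
  constructor
  · intro h
    refine ⟨fun i => ?_, ?_⟩
    · have := h.inv i
      rw [extendNat_coe, extendNat_coe] at this
      exact Fin.ext this
    · rintro ⟨i, j, k, l, h1, h2, h3, h4, h5, h6⟩
      obtain ⟨-, -, inv, nc⟩ := h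
      simp only [Fin.lt_def, ← extendNat_coe] at *
      generalize extendNat π = g at *
      -- `a1` and `a3` force `g i < j`, hence `g l < k`; then the arcs from `g k < g l` to `k < l`
      -- cross, against `a2`.
      have a1 := nc i j h1
      have a2 := nc (g k) (g l) h4
      rw [inv, inv] at a2
      have a3 : j ≠ g i := by
        intro h; rw [h, inv] at h6; rw [h] at h1; omega
      omega
  · rintro ⟨hinv, hc⟩
    have inv : ∀ i, extendNat π (extendNat π i) = i := by
      intro i
      rcases lt_or_ge i n with h | h
      · rw [extendNat_of_lt π i h, extendNat_coe, hinv]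
      · rw [extendNat_of_ge π i h, extendNat_of_ge π i h]
    refine ⟨fun i hi => absurd hi (by omega), fun i hi => extendNat_of_ge π i (by omega), inv,
      fun i j h1 h2 => ?_⟩
    by_contra h3
    have hi : i < n := by
      by_contra h; rw [extendNat_of_ge π i (by omega)] at h2; omega
    rw [extendNat_of_lt π i hi] at h2 h3
    have hj : j < n := by omega
    rw [extendNat_of_lt π j hj] at h3
    have h4 : π ⟨i, hi⟩ ≠ π ⟨j, hj⟩ := by
      intro h; have := π.injective h; rw [Fin.mk.injEq] at this; omega
    have h5 : π ⟨i, hi⟩ < π ⟨j, hj⟩ := lt_of_le_of_ne (by rw [Fin.le_def]; omega) h4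
    refine hc ⟨⟨i, hi⟩, ⟨j, hj⟩, π ⟨i, hi⟩, π ⟨j, hj⟩, h1, h2, h5, ?_, ?_, h5⟩
    · rwa [hinv, hinv]
    · rwa [hinv]

theorem exists_extendNat_eq {n : ℕ} {g : ℕ → ℕ} (hg : IsNoncrossing g 0 n) :
    ∃ π : Equiv.Perm (Fin n), extendNat π = g := by
  have hlt : ∀ i : Fin n, g i < n := fun i => by
    have := (hg.mem i (by omega) (by omega)).2; omega
  have hinv : Function.Involutive fun i : Fin n => (⟨g i, hlt i⟩ : Fin n) := fun i =>
    Fin.ext (hg.inv i)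
  refine ⟨hinv.toPerm, funext fun i => ?_⟩
  rcases lt_or_ge i n with h | h
  · rw [extendNat_of_lt _ _ h]; rfl
  · rw [extendNat_of_ge _ _ h, hg.ge i (by omega)]

theorem fix_eq_sum {n : ℕ} (π : Equiv.Perm (Fin n)) :
    fix π = ∑ i ∈ Finset.Ico 0 (0 + n), if extendNat π i = i then 1 else 0 := by
  rw [fix, ← Finset.card_filter, ← Set.ncard_coe_finset,
    ← Set.ncard_image_of_injective _ Fin.val_injective]
  congr 1
  ext i
  simp only [Set.mem_image, Set.mem_ofPred_eq, Finset.coe_filter, Finset.mem_Ico]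
  constructor
  · rintro ⟨j, hj, rfl⟩
    rw [extendNat_coe, hj]
    exact ⟨by omega, rfl⟩
  · rintro ⟨h1, h2⟩
    refine ⟨⟨i, by omega⟩, Fin.ext ?_, rfl⟩
    rwa [extendNat_of_lt _ _ (by omega)] at h2

theorem consecOcc_eq_sum {n : ℕ} (π : Equiv.Perm (Fin n)) : consecOcc ![1, 2, 3] π =
    ∑ i ∈ Finset.Ico 0 (0 + n), if i + 2 < 0 + n ∧ extendNat π i < extendNat π (i + 1) ∧
      extendNat π (i + 1) < extendNat π (i + 2) then 1 else 0 := by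
  rw [consecOcc, ← Finset.card_filter, ← Set.ncard_coe_finset,
    -- An occurrence is determined by its first position.
    ← Set.InjOn.ncard_image (f := fun f : Fin 3 → Fin n => (f 0 : ℕ))]
  · congr 1
    ext i
    simp only [Set.mem_image, Set.mem_ofPred_eq, Finset.coe_filter, Finset.mem_Ico]
    constructor
    · rintro ⟨f, ⟨⟨j, hj⟩, ho⟩, rfl⟩
      have h0 := hj 0
      have h1 := hj 1
      have h2 := hj 2
      simp only [Fin.val_zero, Fin.val_one, Fin.val_two] at h0 h1 h2
      rw [show (f 0 : ℕ) + 1 = f 1 by omega, show (f 0 : ℕ) + 2 = f 2 by omega]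
      simp only [extendNat_coe]
      exact ⟨by omega, by omega, (ho 0 1).1 (by decide), (ho 1 2).1 (by decide)⟩
    · rintro ⟨-, h1, h2, h3⟩
      rw [extendNat_of_lt _ _ (show i + 1 < n by omega)] at h2 h3
      rw [extendNat_of_lt _ _ (by omega)] at h2 h3
      refine ⟨![⟨i, by omega⟩, ⟨i + 1, by omega⟩, ⟨i + 2, by omega⟩], ⟨⟨i, ?_⟩, ?_⟩, rfl⟩
      · intro a
        fin_cases a <;> rfl
      · intro a b
        simp only [Fin.lt_def]
        fin_cases a <;> fin_cases b <;> simp <;> omega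
  · rintro f ⟨⟨i, hi⟩, -⟩ g ⟨⟨j, hj⟩, -⟩ h
    funext a
    have h0 := hi 0
    have h1 := hj 0
    simp only [Fin.val_zero] at h0 h1 h
    have h2 := hi a
    have h3 := hj a
    exact Fin.ext (by omega)

theorem count123_eq (e : Fin 3 →₀ ℕ) :
    count123 (e 0) (e 1) (e 2) = Set.ncard {t : Shape | t.weight = e} := by
  rw [count123, ← Set.ncard_image_of_injective _ (extendNat_injective (e 0)),
    ← Set.InjOn.ncard_image (f := fun t : Shape => t.toFun 0)
      (s := {t : Shape | t.weight = e})]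
  · congr 1
    ext g
    simp only [Set.mem_image, Set.mem_ofPred_eq]
    constructor
    · rintro ⟨π, ⟨h1, h2, h3⟩, rfl⟩
      obtain ⟨t, ht, ht'⟩ := Shape.exists_toFun_eq _ _ _ ((isNoncrossing_extendNat_iff π).2 h1)
      refine ⟨t, ?_, ht'⟩
      rw [consecOcc_eq_sum, ← ht', ← ht, Shape.doubleAscents_eq] at h2
      rw [fix_eq_sum, ← ht', ← ht, Shape.fixed_eq] at h3
      ext i
      fin_cases i
      · exact (t.weight_zero).trans ht
      · exact (t.weight_one).trans h2
      · exact (t.weight_two).trans h3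
    · rintro ⟨t, rfl, rfl⟩
      rw [t.weight_zero, t.weight_one, t.weight_two]
      have ht := Shape.isNoncrossing_toFun t 0
      obtain ⟨π, hπ⟩ := exists_extendNat_eq ht
      refine ⟨π, ⟨(isNoncrossing_extendNat_iff π).1 (hπ ▸ ht), ?_, ?_⟩, hπ⟩
      · rw [consecOcc_eq_sum, hπ, Shape.doubleAscents_eq]
      · rw [fix_eq_sum, hπ, Shape.fixed_eq]
  · intro s hs t ht h
    refine Shape.toFun_injective s t 0 ?_ h
    rw [Set.mem_ofPred_eq] at hs ht
    rw [← s.weight_zero, ← t.weight_zero, hs, ht]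

theorem F123_eq_weightSeries : F123 = weightSeries Shape.weight := by
  ext e
  rw [coeff_weightSeries, ← count123_eq]
  rfl

theorem F123_quadratic :
    (F123 - 1 - (MvPowerSeries.X 0 * MvPowerSeries.X 2 + MvPowerSeries.X 0 ^ 2 * F123)) *
      (1 - (MvPowerSeries.X 0 * MvPowerSeries.X 1 * MvPowerSeries.X 2 +
        MvPowerSeries.X 0 ^ 2 * F123)) =
      (MvPowerSeries.X 0 * MvPowerSeries.X 2 + MvPowerSeries.X 0 ^ 2 * F123) ^ 2 :=
  weightSeries_weight_quadratic F123_eq_weightSeries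

theorem constantCoeff_F123 : MvPowerSeries.constantCoeff F123 = 1 := by
  rw [F123_eq_weightSeries, weightSeries_weight]
  simp

/-! ### Solving the quadratic in the fraction field -/

theorem toFrac_injective : Function.Injective toFrac := IsFractionRing.injective Series Frac

theorem toFrac_ne_zero {S : Series} (h : MvPowerSeries.constantCoeff S ≠ 0) : toFrac S ≠ 0 := by
  intro h0
  rw [map_eq_zero_iff _ toFrac_injective] at h0
  rw [h0, map_zero] at h
  exact h rfl

theorem toFrac_inv {S : Series} (h : MvPowerSeries.constantCoeff S ≠ 0) :
    toFrac S⁻¹ = (toFrac S)⁻¹ := by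
  rw [eq_comm, inv_eq_iff_eq_inv, eq_comm]
  refine inv_eq_of_mul_eq_one_right ?_
  rw [← map_mul, MvPowerSeries.inv_mul_cancel _ h, map_one]

/-- A power series with constant term `1` is the only square root of its square with constant
term `1`. -/
theorem eq_of_sq_eq_sq_of_constantCoeff {S T : Series} (h : toFrac S ^ 2 = toFrac T ^ 2)
    (hS : MvPowerSeries.constantCoeff S = 1) (hT : MvPowerSeries.constantCoeff T = 1) :
    S = T := by
  rw [← map_pow, ← map_pow] at h
  rcases sq_eq_sq_iff_eq_or_eq_neg.1 (toFrac_injective h) with h | h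
  · exact h
  · rw [h, map_neg, hT] at hS
    norm_num at hS

section Algebra
variable {K : Type*} [Field K]

theorem sq_eq_of_quadratic {x t z F : K} (hd : den x t z ≠ 0) (hF : F ≠ 0)
    (h : (F - 1 - (x * z + x ^ 2 * F)) * (1 - (x * t * z + x ^ 2 * F)) =
      (x * z + x ^ 2 * F) ^ 2) :
    (2 * F⁻¹ - 1 - C x t z + 2 * B x t z) ^ 2 = (1 - C x t z) ^ 2 - 4 * A x t z ^ 2 := by
  -- As `1 + C - 2B = (1 - B) + (C - B)`, this quadratic in `1/F` has discriminant `(1 - C)² - 4A²`.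
  -- It is `h` up to the factor `-1/den`.
  have key : 1 - F * (1 - 2 * B x t z + C x t z) + F ^ 2 * ((1 - B x t z) * (C x t z - B x t z)
      + A x t z ^ 2) = 0 := by
    rw [A, B, C]
    have hden : den x t z = 1 - x * z * (t - 1) - x ^ 2 * z ^ 2 * (t - 1) := rfl
    generalize den x t z = d at hd hden ⊢
    field_simp
    rw [hden]
    linear_combination -(1 - x * z * (t - 1) - x ^ 2 * z ^ 2 * (t - 1)) * h
  field_simp
  linear_combination 4 * key

end Algebra

end PatternInvolutions

namespace PatternInvolutions
open MvPowerSeries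

/-- The power series `den`. -/
noncomputable def denSeries : Series :=
  1 - X 0 * X 2 * (X 1 - 1) - X 0 ^ 2 * X 2 ^ 2 * (X 1 - 1)

theorem constantCoeff_denSeries : constantCoeff denSeries = 1 := by
  simp [denSeries]

section
variable {x t z : Frac} (hx : x = toFrac (X 0)) (ht : t = toFrac (X 1)) (hz : z = toFrac (X 2))
include hx ht hz

theorem toFrac_denSeries : toFrac denSeries = den x t z := by
  simp only [denSeries, den, hx, ht, hz, map_sub, map_mul, map_pow, map_one]

theorem den_ne_zero : den x t z ≠ 0 := by
  rw [← toFrac_denSeries hx ht hz]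
  exact toFrac_ne_zero (by rw [constantCoeff_denSeries]; exact one_ne_zero)

theorem toFrac_inv_denSeries : toFrac denSeries⁻¹ = (den x t z)⁻¹ := by
  rw [toFrac_inv (by rw [constantCoeff_denSeries]; exact one_ne_zero),
    toFrac_denSeries hx ht hz]

/-- `A` is `x` times a series with constant term `1`. -/
theorem A_ne_zero : A x t z ≠ 0 := by
  have h : A x t z = toFrac (X 0) *
      toFrac (1 + X 0 ^ 2 * X 2 ^ 2 * (X 1 - 1) * denSeries⁻¹) := by
    simp only [map_add, map_mul, map_pow, map_sub, map_one, toFrac_inv_denSeries hx ht hz,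
      ← hx, ← ht, ← hz, A]
    ring
  rw [h]
  refine mul_ne_zero ?_ (toFrac_ne_zero (by simp))
  rw [Ne, map_eq_zero_iff _ toFrac_injective]
  intro h
  have := congrArg (coeff (Finsupp.single 0 1)) h
  rw [coeff_index_single_self_X, map_zero] at this
  exact one_ne_zero this

/-- This expression is the claimed formula solved for its square root; its constant term is `2 - 1 =
1`, which selects the sign. -/
theorem exists_sqrt : ∃ S : Series, constantCoeff S = 1 ∧
    toFrac S = 2 * (toFrac F123)⁻¹ - 1 - C x t z + 2 * B x t z := by
  have hF : constantCoeff F123 ≠ 0 := by rw [constantCoeff_F123]; exact one_ne_zero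
  refine ⟨2 * F123⁻¹ - 1 - (X 0 * X 2 + X 0 ^ 3 * X 2 ^ 2 * (X 1 - 1) *
    (X 2 + X 0 * (X 1 - 1) + X 0 ^ 2 * (X 1 - 1) * X 2) * denSeries⁻¹ +
      X 0 ^ 3 * (X 1 - 1) * X 2) + 2 * (X 0 * X 2 + X 0 ^ 3 * X 2 ^ 3 * (X 1 - 1) *
        denSeries⁻¹), ?_, ?_⟩
  · have h2 : constantCoeff (2 : Series) = 2 := map_ofNat _ 2
    simp [constantCoeff_F123, h2]
    norm_num
  · simp only [map_add, map_mul, map_pow, map_sub, map_one, map_ofNat,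
      toFrac_inv_denSeries hx ht hz, toFrac_inv hF, ← hx, ← ht, ← hz, B, C]
    ring

end

end PatternInvolutions

open PatternInvolutions in
theorem mainTheorem5 (x t z : Frac)
    (hx : x = toFrac (MvPowerSeries.X 0)) (ht : t = toFrac (MvPowerSeries.X 1))
    (hz : z = toFrac (MvPowerSeries.X 2)) :
    den x t z ≠ 0 ∧
    -- the square root: the unique series with constant term `1` and the prescribed square
    (∃! S : Series, MvPowerSeries.constantCoeff S = 1 ∧
        toFrac S ^ 2 = (1 - C x t z) ^ 2 - 4 * A x t z ^ 2) ∧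
    ∀ S : Series, MvPowerSeries.constantCoeff S = 1 →
      toFrac S ^ 2 = (1 - C x t z) ^ 2 - 4 * A x t z ^ 2 →
      2 * (1 - B x t z) * A x t z ^ 2 - A x t z ^ 2 + A x t z ^ 2 * C x t z
          + A x t z ^ 2 * toFrac S ≠ 0 ∧
      toFrac F123 = 2 * A x t z ^ 2 /
        (2 * (1 - B x t z) * A x t z ^ 2 - A x t z ^ 2 + A x t z ^ 2 * C x t z
          + A x t z ^ 2 * toFrac S) := by

  have hd := den_ne_zero hx ht hz
  have hA := A_ne_zero hx ht hz
  have hF : toFrac F123 ≠ 0 := toFrac_ne_zero (by rw [constantCoeff_F123]; exact one_ne_zero)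
  obtain ⟨R, hR, hR'⟩ := exists_sqrt hx ht hz
  have hq := congrArg toFrac F123_quadratic
  simp only [map_mul, map_sub, map_add, map_pow, map_one, ← hx, ← ht, ← hz] at hq
  have hsq := sq_eq_of_quadratic hd hF hq
  rw [← hR'] at hsq
  refine ⟨hd, ⟨R, ⟨hR, hsq⟩, fun S hS =>
    eq_of_sq_eq_sq_of_constantCoeff (hS.2.trans hsq.symm) hS.1 hR⟩, fun S hS hS' => ?_⟩
  obtain rfl := eq_of_sq_eq_sq_of_constantCoeff (hS'.trans hsq.symm) hS hR
  have hden : 2 * (1 - B x t z) * A x t z ^ 2 - A x t z ^ 2 + A x t z ^ 2 * C x t z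
      + A x t z ^ 2 * toFrac S = 2 * A x t z ^ 2 * (toFrac F123)⁻¹ := by
    rw [hR']; ring
  have h2 : (2 : Frac) ≠ 0 := by
    rw [← map_ofNat toFrac 2]
    exact toFrac_ne_zero (by rw [map_ofNat]; exact two_ne_zero)
  rw [hden]
  have h2A : 2 * A x t z ^ 2 ≠ 0 := mul_ne_zero h2 (pow_ne_zero 2 hA)
  exact ⟨mul_ne_zero h2A (inv_ne_zero hF), by field_simp⟩
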